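/- Let $S=(-\frac{\pi}{2},\frac{\pi}{2})^2\subset\mathbb R^2$, let $\Theta\subset\mathbb R$ be open, $h_0>0$, and let $\Phi(x,y,\theta,h)$, $\theta\in\Theta$, $h\in[0,h_0)$, be a family of functions that is jointly $C^\infty$ in $(x,y,\theta,h)$ for $(x,y)\in\overline S$ (up to $\partial S$ and up to $h=0$), such that each $\Phi(\cdot,\theta,h)$ is an eigenfunction of the $h$-Robin Laplacian on $S$ with an eigenvalue $\lambda(h)$: it is not identically zero, $-\Delta\Phi(\cdot,\theta,h)=\lambda(h)\Phi(\cdot,\theta,h)$ in $S$, and $\partial_\nu\Phi(\cdot,\theta,h)+h\,\Phi(\cdot,\theta,h)=0$ on the sides of $S$, where $\nu$ is the outward unit normal. Let $z_0$ be a point of one side of $S$, not a corner, let $\partial_\tau$ be the tangential derivative along this side (so $\partial_\tau=\partial_y$ if $z_0=(-\frac{\pi}{2},y_0)$ with $|y_0|<\frac{\pi}{2}$), and let $\theta_0\in\Theta$ be such that $$\Phi(z_0,\theta_0,0)=0,\qquad \partial_\tau\Phi(z_0,\theta_0,0)=0,\qquad \partial_\tau^2\Phi(z_0,\theta_0,0)\neq0,\qquad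 \partial_\theta\Phi(z_0,\theta_0,0)\neq0 .$$ Assume also that for some $\epsilon_1,\eta_1>0$ the family is defined and jointly $C^\infty$ for $(x,y)$ in the full disc $B(z_0,\epsilon_1)\subset\mathbb R^2$ and all $\theta\in\Theta$, $h\in[0,h_0)$ with $|\theta-\theta_0|+h\le\eta_1$, and satisfies $-\Delta\Phi(\cdot,\theta,h)=\lambda(h)\Phi(\cdot,\theta,h)$ there. Then there exist $\epsilon_0\in(0,\epsilon_1)$ and $\eta_0\in(0,\eta_1)$ such that the number of nodal domains of $\Phi(\cdot,\theta,h)$ in $B(z_0,\epsilon_0)\cap S$, i.e. the number of connected components of $\{z\in B(z_0,\epsilon_0)\cap S:\Phi(z,\theta,h)\neq0\}$, is exactly $3$ for $(\theta,h)=(\theta_0,0)$ and at most $3$ for all $\theta\in\Theta$, $h\in[0,h_0)$ with $|\theta-\theta_0|+h\le\eta_0$. -/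

import Mathlib

open Set Real
open scoped ContDiff Laplacian

/-- The Euclidean plane `ℝ²`. -/
abbrev Plane : Type := EuclideanSpace ℝ (Fin 2)

/-- The open square `S = (-π/2, π/2)²`. -/
def openSquare : Set Plane := {z | ∀ k, z k ∈ Ioo (-(π / 2)) (π / 2)}

/-- The closed square, the closure of `S`. -/
def closedSquare : Set Plane := {z | ∀ k, z k ∈ Icc (-(π / 2)) (π / 2)}

/-- The unit vector of the `k`-th coordinate axis. -/
noncomputable def axisVec (k : Fin 2) : Plane := EuclideanSpace.single k (1 : ℝ)

/-- For `σ = ± 1`, the side of `S` on the line `z i = σ π / 2`, without its two end points (the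
corners). Its outward unit normal is `σ • axisVec i`. -/
def openSide (i : Fin 2) (σ : ℝ) : Set Plane :=
  {z | z i = σ * (π / 2) ∧ ∀ k, k ≠ i → z k ∈ Ioo (-(π / 2)) (π / 2)}

/-- The `h`-Robin condition `∂f/∂ν + h f = 0` on the four sides of `S`, with `ν` the outward unit
normal (one-sided derivative, taken from inside the closed square). -/
def RobinCondition (h : ℝ) (f : Plane → ℝ) : Prop :=
  ∀ (i : Fin 2) (σ : ℝ), σ = 1 ∨ σ = -1 → ∀ z ∈ openSide i σ,
    lineDerivWithin ℝ f closedSquare z (σ • axisVec i) + h * f z = 0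

/-- `f`, smooth up to the boundary of `S`, is an eigenfunction of the `h`-Robin Laplacian on `S`
with eigenvalue `ev`. -/
structure IsRobinEigenfunction (h ev : ℝ) (f : Plane → ℝ) : Prop where
  smooth : ContDiffOn ℝ ∞ f closedSquare
  ne_zero : ∃ z ∈ openSquare, f z ≠ 0
  eigen : ∀ z ∈ openSquare, -(Δ f z) = ev * f z
  robin : RobinCondition h f

/-- `Φ(·, θ, h)`, for `θ ∈ Θ` and `h ∈ [0, h₀)`, is a `C^∞` family (jointly in all variables) of
Robin eigenfunctions on `S`, where `Φ(·, θ, h)` satisfies the `h`-Robin condition and has the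
eigenvalue `ev h`. -/
structure IsSmoothRobinFamily (Θ : Set ℝ) (h₀ : ℝ) (ev : ℝ → ℝ) (Φ : Plane → ℝ → ℝ → ℝ) :
    Prop where
  smooth : ContDiffOn ℝ ∞ (fun p : Plane × ℝ × ℝ => Φ p.1 p.2.1 p.2.2)
    (closedSquare ×ˢ (Θ ×ˢ Ico 0 h₀))
  eigenfunction : ∀ θ ∈ Θ, ∀ h ∈ Ico 0 h₀, IsRobinEigenfunction h (ev h) (fun z => Φ z θ h)

/-- The nodal domains of `f` in `U`: the connected components of `{z ∈ U | f z ≠ 0}`. -/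
def nodalDomains (f : Plane → ℝ) (U : Set Plane) : Set (Set Plane) :=
  {C | ∃ z ∈ {w ∈ U | f w ≠ 0}, C = connectedComponentIn {w ∈ U | f w ≠ 0} z}

/-! Let x be the inward normal and s the tangential coordinate at z₀, let a = ∂_τ²Φ(z₀, θ₀, 0), and
put G = aΦ. Since Φ vanishes at z₀, the equation gives ΔΦ = 0 there, so the second normal derivative
is -a. By joint smoothness, G_ss > 0 > G_xx on a small disc for all nearby parameters: G is strictly
convex along the side and strictly concave across it.

The Robin condition reads G_x = hG at x = 0. With h ≥ 0 and concavity in x, it makes G negative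
further inward from any point where G ≤ 0 (`neg_of_strictConcaveOn_of_robin`). Thus {G < 0} is
stable under moving inward and {G > 0} under moving towards the side.

So {G > 0} is governed by its trace on x = 0, the complement of an interval by convexity in s: at
most two pieces (`isPreconnected_pos`). The set {G < 0} can be pushed inward to a fixed depth, where
its slices are intervals, and is connected (`isPreconnected_neg`). This gives at most three pieces.
At the base parameters G(0, s) > 0 for s ≠ 0 and G(x, 0) < 0 for x > 0, so all three are nonempty
and they are exactly the components. -/

/-! ### Counting components from a cover by connected pieces. -/

/-- Each piece lies in a single component. The pieces may be empty or touch one another, so only an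
upper bound results. -/
theorem nodalDomains_encard_le_three {f : Plane → ℝ} {U A B C : Set Plane}
    (hA : IsPreconnected A) (hB : IsPreconnected B) (hC : IsPreconnected C)
    (hW : {w ∈ U | f w ≠ 0} = A ∪ (B ∪ C)) : (nodalDomains f U).encard ≤ 3 := by
  classical
  set W := {w ∈ U | f w ≠ 0} with hWdef
  -- The component containing a given piece; the value ∅ for an empty piece is a dummy and can only
  -- enlarge the covering set.
  let r : Set Plane → Set Plane := fun A =>
    if h : A.Nonempty then connectedComponentIn W h.some else ∅
  have key : ∀ A : Set Plane, IsPreconnected A → A ⊆ W → ∀ z ∈ A,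
      connectedComponentIn W z = r A := by
    intro A hA hAW z hz
    have hne : A.Nonempty := ⟨z, hz⟩
    simp only [r, dif_pos hne]
    exact (connectedComponentIn_eq
      ((hA.subset_connectedComponentIn hz hAW) hne.some_mem))
  have hsub : nodalDomains f U ⊆ {r A, r B, r C} := by
    rintro D ⟨z, hz, rfl⟩
    rw [← hWdef]
    have hz' : z ∈ A ∪ (B ∪ C) := hW ▸ hz
    rcases hz' with h | h | h
    · left; exact key A hA (hW ▸ fun w hw => Or.inl hw) z h
    · right; left; exact key B hB (hW ▸ fun w hw => Or.inr (Or.inl hw)) z h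
    · right; right; exact key C hC (hW ▸ fun w hw => Or.inr (Or.inr hw)) z h
  calc (nodalDomains f U).encard ≤ ({r A, r B, r C} : Set (Set Plane)).encard :=
        encard_le_encard hsub
    _ ≤ ({r B, r C} : Set (Set Plane)).encard + 1 := encard_insert_le _ _
    _ ≤ (({r C} : Set (Set Plane)).encard + 1) + 1 := by gcongr; exact encard_insert_le _ _
    _ = 3 := by rw [encard_singleton]; norm_num

/-- A connected open piece whose complement in the nodal set is open is a whole component, so
disjoint nonempty pieces are counted exactly. -/
theorem nodalDomains_encard_eq_three {f : Plane → ℝ} {U A B C : Set Plane}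
    (hA : IsPreconnected A) (hB : IsPreconnected B) (hC : IsPreconnected C)
    (hAo : IsOpen A) (hBo : IsOpen B) (hCo : IsOpen C)
    (hAn : A.Nonempty) (hBn : B.Nonempty) (hCn : C.Nonempty)
    (hAB : Disjoint A B) (hAC : Disjoint A C) (hBC : Disjoint B C)
    (hW : {w ∈ U | f w ≠ 0} = A ∪ (B ∪ C)) : (nodalDomains f U).encard = 3 := by
  have key : ∀ A B W : Set Plane, IsPreconnected A → IsOpen A → IsOpen B → Disjoint A B →
      W = A ∪ B → ∀ z ∈ A, connectedComponentIn W z = A := by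
    rintro A B W hA hAo hBo hAB rfl z hz
    refine subset_antisymm ?_ (hA.subset_connectedComponentIn hz subset_union_left)
    refine IsPreconnected.subset_left_of_subset_union hAo hBo hAB
      (connectedComponentIn_subset _ _)
      ⟨z, mem_connectedComponentIn (Or.inl hz), hz⟩ isPreconnected_connectedComponentIn
  have kA := key A (B ∪ C) _ hA hAo (hBo.union hCo) (hAB.union_right hAC) hW
  have kB := key B (A ∪ C) _ hB hBo (hAo.union hCo) (hAB.symm.union_right hBC)
    (hW.trans (by ac_rfl))
  have kC := key C (A ∪ B) _ hC hCo (hAo.union hBo) (hAC.symm.union_right hBC.symm)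
    (hW.trans (by ac_rfl))
  have hne : ∀ A B : Set Plane, A.Nonempty → Disjoint A B → A ≠ B := by
    rintro A _ ⟨x, hx⟩ hd rfl
    exact disjoint_left.1 hd hx hx
  refine encard_eq_three.2 ⟨A, B, C, hne _ _ hAn hAB, hne _ _ hAn hAC, hne _ _ hBn hBC, ?_⟩
  ext D
  constructor
  · rintro ⟨z, hz, rfl⟩
    have hz' : z ∈ A ∪ (B ∪ C) := hW ▸ hz
    rcases hz' with h | h | h
    · left; exact kA z h
    · right; left; exact kB z h
    · right; right; exact kC z h
  · rintro (rfl | rfl | rfl)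
    · obtain ⟨z, hz⟩ := hAn
      exact ⟨z, hW ▸ Or.inl hz, (kA z hz).symm⟩
    · obtain ⟨z, hz⟩ := hBn
      exact ⟨z, hW ▸ Or.inr (Or.inl hz), (kB z hz).symm⟩
    · obtain ⟨z, hz⟩ := hCn
      exact ⟨z, hW ▸ Or.inr (Or.inr hz), (kC z hz).symm⟩

/-! ### Connectedness of the sign sets in a half-disc. -/

/-- The open half-disc of radius `ε` in the coordinates `(x, s)`, on the side `x > 0`. -/
def halfDisc (ε : ℝ) : Set (ℝ × ℝ) := {p | 0 < p.1 ∧ p.1 ^ 2 + p.2 ^ 2 < ε ^ 2}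

theorem joinedIn_vertical {W : Set (ℝ × ℝ)} {x y s : ℝ} (hxy : x ≤ y)
    (h : ∀ t ∈ Icc x y, (t, s) ∈ W) : JoinedIn W (x, s) (y, s) := by
  refine JoinedIn.of_segment_subset ?_
  rw [← Prod.image_mk_segment_left, segment_eq_Icc hxy]
  rintro _ ⟨t, ht, rfl⟩
  exact h t ht

theorem joinedIn_horizontal {W : Set (ℝ × ℝ)} {x s t : ℝ}
    (h : ∀ u ∈ uIcc s t, (x, u) ∈ W) : JoinedIn W (x, s) (x, t) := by
  refine JoinedIn.of_segment_subset ?_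
  rw [← Prod.image_mk_segment_right, segment_eq_uIcc]
  rintro _ ⟨u, hu, rfl⟩
  exact h u hu

theorem isPreconnected_of_joinedIn {X : Type*} [TopologicalSpace X] {W : Set X}
    (h : ∀ x ∈ W, ∀ y ∈ W, JoinedIn W x y) : IsPreconnected W := by
  refine isPreconnected_of_forall_pair fun x hx y hy => ?_
  obtain ⟨γ, hγ⟩ := h x hx y hy
  refine ⟨range γ, by rintro _ ⟨t, rfl⟩; exact hγ t, ⟨0, γ.source⟩, ⟨1, γ.target⟩,
    isPreconnected_range γ.continuous⟩

theorem sq_lt_of_mem_uIcc {s t u a : ℝ} (hs : s ^ 2 < a) (ht : t ^ 2 < a) (hu : u ∈ uIcc s t) :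
    u ^ 2 < a := by
  have h : |u| ≤ max |s| |t| := by
    rcases mem_uIcc.1 hu with h | h
    · exact abs_le_max_abs_abs h.1 h.2
    · exact (abs_le_max_abs_abs h.1 h.2).trans (max_comm _ _).le
  rcases le_max_iff.1 h with h | h
  · exact (sq_le_sq.2 h).trans_lt hs
  · exact (sq_le_sq.2 h).trans_lt ht

/-- The set `{G < 0}` in the half-disc is connected. -/
theorem isPreconnected_neg {ε κ : ℝ} (hκ : 0 < κ) (hκε : κ ≤ ε / 2) {G : ℝ → ℝ → ℝ}
    (hV : ∀ s x y, 0 ≤ x → x < y → y ^ 2 + s ^ 2 < ε ^ 2 → G x s ≤ 0 → G y s < 0)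
    (hH : ∀ x s t u, 0 ≤ x → x ^ 2 + s ^ 2 < ε ^ 2 → x ^ 2 + t ^ 2 < ε ^ 2 → u ∈ uIcc s t →
      G x u ≤ max (G x s) (G x t))
    (hG : G κ 0 < 0)
    (hp : ∀ x ∈ Icc 0 κ, G x 0 < G x (ε / 2)) (hm : ∀ x ∈ Icc 0 κ, G x 0 < G x (-(ε / 2))) :
    IsPreconnected {p ∈ halfDisc ε | G p.1 p.2 < 0} := by
  set N := {p ∈ halfDisc ε | G p.1 p.2 < 0} with hN
  have hκ2 : κ ^ 2 ≤ ε ^ 2 / 4 := by nlinarith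
  have hε2 : 0 < ε ^ 2 := by nlinarith
  have vert : ∀ x y s, 0 < x → x ≤ y → y ^ 2 + s ^ 2 < ε ^ 2 → G x s < 0 →
      JoinedIn N (x, s) (y, s) := by
    intro x y s hx hxy hy hneg
    refine joinedIn_vertical hxy fun t ht => ?_
    have h1 : t ^ 2 + s ^ 2 < ε ^ 2 := by
      have : t ^ 2 ≤ y ^ 2 := pow_le_pow_left₀ (hx.le.trans ht.1) ht.2 2
      linarith
    refine ⟨⟨hx.trans_le ht.1, h1⟩, ?_⟩
    rcases ht.1.eq_or_lt with rfl | hlt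
    · exact hneg
    · exact hV s x t hx.le hlt h1 hneg.le
  have hor : ∀ x s t, 0 < x → x ^ 2 + s ^ 2 < ε ^ 2 → x ^ 2 + t ^ 2 < ε ^ 2 → G x s < 0 →
      G x t < 0 → JoinedIn N (x, s) (x, t) := by
    intro x s t hx hs ht hGs hGt
    refine joinedIn_horizontal fun u hu => ?_
    refine ⟨⟨hx, ?_⟩, (hH x s t u hx.le hs ht hu).trans_lt (max_lt hGs hGt)⟩
    show x ^ 2 + u ^ 2 < ε ^ 2
    linarith [sq_lt_of_mem_uIcc (lt_sub_iff_add_lt'.2 hs) (lt_sub_iff_add_lt'.2 ht) hu]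
  -- Every negative point is joined to (κ, 0). If x ≥ κ, slide to s = 0 and then back along the
  -- axis. If x ≤ κ, first bring s into [-ε/2, ε/2], so that moving inward to depth κ stays in the
  -- disc.
  have center : ∀ p ∈ N, JoinedIn N p (κ, 0) := by
    rintro ⟨x, s⟩ ⟨⟨hx, hd⟩, hneg⟩
    simp only at hx hd hneg
    rcases le_total κ x with hle | hle
    · have hx0 : x ^ 2 + (0 : ℝ) ^ 2 < ε ^ 2 := by nlinarith [sq_nonneg s]
      have h0 : G x 0 < 0 := by
        rcases hle.eq_or_lt with rfl | hlt
        · exact hG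
        · exact hV 0 κ x hκ.le hlt hx0 hG.le
      exact (hor x s 0 hx hd hx0 hneg h0).trans (vert κ x 0 hκ hle hx0 hG).symm
    · have hmem : x ∈ Icc 0 κ := ⟨hx.le, hle⟩
      have hx2 : x ^ 2 ≤ κ ^ 2 := pow_le_pow_left₀ hx.le hle 2
      have hx0 : x ^ 2 + (0 : ℝ) ^ 2 < ε ^ 2 := by nlinarith
      -- For s beyond ±ε/2, the value at ±ε/2 is at most the larger of those at s and 0. It exceeds
      -- the value at 0, so it is bounded by G x s < 0.
      obtain ⟨t, ht, hGt⟩ : ∃ t : ℝ, t ^ 2 ≤ ε ^ 2 / 4 ∧ G x t < 0 := by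
        by_cases h1 : ε / 2 ≤ s
        · refine ⟨ε / 2, by nlinarith, ?_⟩
          have := hH x s 0 (ε / 2) hx.le hd hx0 (mem_uIcc.2 (Or.inr ⟨by linarith, h1⟩))
          rcases le_max_iff.1 this with h | h
          · linarith
          · linarith [hp x hmem]
        · by_cases h2 : s ≤ -(ε / 2)
          · refine ⟨-(ε / 2), by nlinarith, ?_⟩
            have := hH x s 0 (-(ε / 2)) hx.le hd hx0
              (mem_uIcc.2 (Or.inl ⟨h2, by linarith⟩))
            rcases le_max_iff.1 this with h | h
            · linarith
            · linarith [hm x hmem]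
          · exact ⟨s, by push Not at h1 h2; nlinarith, hneg⟩
      have hκt : κ ^ 2 + t ^ 2 < ε ^ 2 := by linarith
      have hGκt : G κ t < 0 := by
        rcases hle.eq_or_lt with rfl | hlt
        · exact hGt
        · exact hV t x κ hx.le hlt hκt hGt.le
      exact (hor x s t hx hd (by linarith) hneg hGt).trans
        ((vert x κ t hx hle hκt hGt).trans (hor κ t 0 hκ hκt (by nlinarith) hGκt hG))
  exact isPreconnected_of_joinedIn fun p hp q hq => (center p hp).trans (center q hq).symm

/-- The part of `{G > 0}` in the half-disc that lies over an interval `I` is connected when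
the trace of `{G > 0}` on `x = 0` meets `I` in an interval. -/
theorem isPreconnected_pos {ε : ℝ} {G : ℝ → ℝ → ℝ}
    (hc : ContinuousOn (fun p : ℝ × ℝ => G p.1 p.2) {p | p.1 ^ 2 + p.2 ^ 2 < ε ^ 2})
    (hV : ∀ s x y, 0 ≤ x → x < y → y ^ 2 + s ^ 2 < ε ^ 2 → G x s ≤ 0 → G y s < 0)
    {I : Set ℝ} (hIo : I.OrdConnected)
    (hI : ∀ s ∈ I, ∀ t ∈ I, s ^ 2 < ε ^ 2 → t ^ 2 < ε ^ 2 → 0 < G 0 s → 0 < G 0 t →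
      ∀ u ∈ uIcc s t, 0 < G 0 u) :
    IsPreconnected {p ∈ halfDisc ε | 0 < G p.1 p.2 ∧ p.2 ∈ I} := by
  set P := {p ∈ halfDisc ε | 0 < G p.1 p.2 ∧ p.2 ∈ I} with hP
  have hPdown : ∀ x y s, 0 < x → x ≤ y → (y, s) ∈ P → (x, s) ∈ P := by
    rintro x y s hx hxy ⟨⟨hy, hd⟩, hpos, hs⟩
    simp only at hy hd hpos hs
    have : x ^ 2 ≤ y ^ 2 := pow_le_pow_left₀ hx.le hxy 2
    refine ⟨⟨hx, by simp only; linarith⟩, ?_, hs⟩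
    rcases hxy.eq_or_lt with rfl | hlt
    · exact hpos
    · by_contra h
      exact absurd (hV s x y hx.le hlt hd (not_lt.1 h)) (not_lt.2 hpos.le)
  refine isPreconnected_of_joinedIn ?_
  rintro ⟨x, s⟩ hxs ⟨y, t⟩ hyt
  have hs0 : ∀ x s, (x, s) ∈ P → 0 < G 0 s ∧ s ^ 2 < ε ^ 2 := by
    rintro x s ⟨⟨hx, hd⟩, hpos, -⟩
    simp only at hx hd hpos
    refine ⟨?_, by nlinarith⟩
    by_contra h
    exact absurd (hV s 0 x le_rfl hx hd (not_lt.1 h)) (not_lt.2 hpos.le)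
  obtain ⟨hGs, hsε⟩ := hs0 x s hxs
  obtain ⟨hGt, htε⟩ := hs0 y t hyt
  have hDo : IsOpen {p : ℝ × ℝ | p.1 ^ 2 + p.2 ^ 2 < ε ^ 2} :=
    isOpen_lt (by fun_prop) (by fun_prop)
  have hO : IsOpen ({p : ℝ × ℝ | p.1 ^ 2 + p.2 ^ 2 < ε ^ 2} ∩
      (fun p : ℝ × ℝ => G p.1 p.2) ⁻¹' Ioi 0) := hc.isOpen_inter_preimage hDo isOpen_Ioi
  -- G is positive on the compact boundary segment between s and t, hence on a thin strip around it.
  -- Both points descend into the strip at a common height m and are joined there.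
  obtain ⟨u, v, hu, -, h0u, hv, huv⟩ := generalized_tube_lemma (s := {(0 : ℝ)})
    isCompact_singleton (t := uIcc s t) isCompact_uIcc hO (by
      rintro ⟨a, b⟩ ⟨ha, hb⟩
      rw [mem_singleton_iff] at ha
      simp only at ha hb
      subst ha
      refine ⟨?_, hI s hxs.2.2 t hyt.2.2 hsε htε hGs hGt b hb⟩
      show (0 : ℝ) ^ 2 + b ^ 2 < ε ^ 2
      linarith [sq_lt_of_mem_uIcc hsε htε hb])
  obtain ⟨r, hr, hru⟩ := Metric.isOpen_iff.1 hu 0 (h0u rfl)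
  obtain ⟨m, hm0, hmr, hmx, hmy⟩ : ∃ m : ℝ, 0 < m ∧ m < r ∧ m ≤ x ∧ m ≤ y :=
    ⟨min (r / 2) (min x y), lt_min (by linarith) (lt_min hxs.1.1 hyt.1.1),
      (min_le_left _ _).trans_lt (by linarith),
      (min_le_right _ _).trans (min_le_left _ _), (min_le_right _ _).trans (min_le_right _ _)⟩
  have hmu : m ∈ u := hru (by simp [abs_of_pos hm0, hmr])
  have hmid : JoinedIn P (m, s) (m, t) := by
    refine joinedIn_horizontal fun a ha => ?_
    obtain ⟨h1, h2⟩ := huv (mk_mem_prod hmu (hv ha))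
    exact ⟨⟨hm0, h1⟩, h2, hIo.uIcc_subset hxs.2.2 hyt.2.2 ha⟩
  have hvs : JoinedIn P (m, s) (x, s) := joinedIn_vertical hmx fun a ha =>
    hPdown a x s (hm0.trans_le ha.1) ha.2 hxs
  have hvt : JoinedIn P (m, t) (y, t) := joinedIn_vertical hmy fun a ha =>
    hPdown a y t (hm0.trans_le ha.1) ha.2 hyt
  exact hvs.symm.trans (hmid.trans hvt)

/-! ### One-variable convexity. -/

theorem strictConvexOn_of_hasDerivAt_pos {D : Set ℝ} (hDo : IsOpen D) (hD : Convex ℝ D)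
    {g g' g'' : ℝ → ℝ} (h1 : ∀ x ∈ D, HasDerivAt g (g' x) x)
    (h2 : ∀ x ∈ D, HasDerivAt g' (g'' x) x) (h3 : ∀ x ∈ D, 0 < g'' x) : StrictConvexOn ℝ D g := by
  refine strictConvexOn_of_deriv2_pos' hD (fun x hx => (h1 x hx).continuousAt.continuousWithinAt)
    fun x hx => ?_
  have : deriv g =ᶠ[nhds x] g' := by
    filter_upwards [hDo.mem_nhds hx] with y hy using (h1 y hy).deriv
  simp only [Function.iterate_succ, Function.iterate_zero, Function.comp_apply, id]
  rw [this.deriv_eq, (h2 x hx).deriv]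
  exact h3 x hx

theorem convex_sq_add_lt (a b : ℝ) : Convex ℝ {x : ℝ | x ^ 2 + a < b} := by
  refine OrdConnected.convex ⟨fun x hx y hy z hz => ?_⟩
  have := sq_lt_of_mem_uIcc (lt_sub_iff_add_lt.2 hx) (lt_sub_iff_add_lt.2 hy)
    (Icc_subset_uIcc hz)
  exact lt_sub_iff_add_lt.1 this

theorem isOpen_sq_add_lt (a b : ℝ) : IsOpen {x : ℝ | x ^ 2 + a < b} :=
  isOpen_lt (by fun_prop) (by fun_prop)

/-- A strictly concave function which satisfies a Robin condition at the left end point stays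
negative once it is nonpositive. -/
theorem neg_of_strictConcaveOn_of_robin {D : Set ℝ} {g : ℝ → ℝ} (hg : StrictConcaveOn ℝ D g)
    {h : ℝ} (hh : 0 ≤ h) (hr : HasDerivAt g (h * g 0) 0) {x y : ℝ} (h0 : 0 ∈ D) (hy : y ∈ D)
    (hx0 : 0 ≤ x) (hxy : x < y) (hgx : g x ≤ 0) : g y < 0 := by
  have hy0 : 0 < y := hx0.trans_lt hxy
  -- If g 0 ≤ 0, the graph lies below its tangent at 0: g y < (1 + h y) g 0 ≤ 0. If g 0 > 0, then g
  -- y ≥ 0 would force g > 0 strictly between 0 and y, in particular at x.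
  rcases le_or_gt (g 0) 0 with hg0 | hg0
  · have := hg.slope_lt_of_hasDerivAt h0 hy hy0 hr
    rw [slope_def_field, div_lt_iff₀ (by linarith)] at this
    nlinarith [mul_nonneg (mul_nonneg hh (neg_nonneg.2 hg0)) hy0.le]
  · by_contra! hgy
    have hx : 0 < x := by
      rcases hx0.eq_or_lt with rfl | h
      · linarith
      · exact h
    have := hg.lt_on_openSegment h0 hy hy0.ne (z := x)
      (by rw [openSegment_eq_Ioo hy0]; exact ⟨hx, hxy⟩)
    have h2 : 0 ≤ min (g 0) (g y) := le_min hg0.le hgy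
    linarith

/-- A strictly convex function lies strictly above its tangent away from the point of contact, and
here the tangent at 0 is the zero line. -/
theorem pos_of_strictConvexOn_of_hasDerivAt_zero {D : Set ℝ} {g : ℝ → ℝ}
    (hg : StrictConvexOn ℝ D g) (h0 : 0 ∈ D) (hg0 : g 0 = 0) (hd : HasDerivAt g 0 0) {s : ℝ}
    (hs : s ∈ D) (hs0 : s ≠ 0) : 0 < g s := by
  rcases hs0.lt_or_gt with h | h
  · have := hg.slope_lt_of_hasDerivAt hs h0 h hd
    rw [slope_def_field, div_lt_iff₀ (by linarith)] at this
    linarith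
  · have := hg.lt_slope_of_hasDerivAt h0 hs h hd
    rw [slope_def_field, lt_div_iff₀ (by linarith)] at this
    linarith

/-! ### Second derivatives along lines. -/

theorem iteratedDeriv_two_line {E : Type*} [NormedAddCommGroup E] [NormedSpace ℝ E] {f : E → ℝ}
    {z : E} (hf : ContDiffAt ℝ 2 f z) (v : E) :
    iteratedDeriv 2 (fun t : ℝ => f (z + t • v)) 0 = iteratedFDeriv ℝ 2 f z ![v, v] := by
  have hline : ∀ t : ℝ, HasDerivAt (fun t : ℝ => z + t • v) v t := fun t => by
    simpa using ((hasDerivAt_id t).smul_const v).const_add z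
  have hd : ∀ᶠ t in nhds (0 : ℝ), HasDerivAt (fun t : ℝ => f (z + t • v))
      (fderiv ℝ f (z + t • v) v) t := by
    have h1 : ∀ᶠ w in nhds z, ContDiffAt ℝ 2 f w := hf.eventually (by simp)
    have h2 : Filter.Tendsto (fun t : ℝ => z + t • v) (nhds 0) (nhds z) := by
      simpa using (hline 0).continuousAt.tendsto
    filter_upwards [h2.eventually h1] with t ht
    exact (ht.differentiableAt (by norm_num)).hasFDerivAt.comp_hasDerivAt t (hline t)
  have hdd : HasDerivAt (fun t : ℝ => fderiv ℝ f (z + t • v) v) (fderiv ℝ (fderiv ℝ f) z v v) 0 := by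
    have h1 : DifferentiableAt ℝ (fderiv ℝ f) z :=
      (hf.fderiv_right (m := 1) (by norm_num)).differentiableAt (by norm_num)
    have h2 : HasFDerivAt (fderiv ℝ f) (fderiv ℝ (fderiv ℝ f) z) (z + (0 : ℝ) • v) := by
      simpa using h1.hasFDerivAt
    have h3 := h2.comp_hasDerivAt (0 : ℝ) (hline 0)
    simpa using h3.clm_apply (hasDerivAt_const (0 : ℝ) v)
  have he : deriv (fun t : ℝ => f (z + t • v)) =ᶠ[nhds 0]
      fun t : ℝ => fderiv ℝ f (z + t • v) v := by
    filter_upwards [hd] with t ht using ht.deriv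
  rw [iteratedDeriv_succ, iteratedDeriv_one, he.deriv_eq, hdd.deriv, iteratedFDeriv_two_apply]
  simp

theorem laplacian_eq_sum_iteratedDeriv {f : Plane → ℝ} {z : Plane} (hf : ContDiffAt ℝ 2 f z) :
    Δ f z = ∑ k, iteratedDeriv 2 (fun t : ℝ => f (z + t • axisVec k)) 0 := by
  rw [InnerProductSpace.laplacian_eq_iteratedFDeriv_orthonormalBasis f
    (EuclideanSpace.basisFun (Fin 2) ℝ)]
  refine Finset.sum_congr rfl fun k _ => ?_
  rw [iteratedDeriv_two_line hf, EuclideanSpace.basisFun_apply]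
  rfl

/-- The parameter set contains its edge h = 0, so joint derivatives are taken within a set that need
not be open. They are chosen as functions, which avoids any uniqueness question. -/
theorem exists_hasFDerivWithinAt_two {E : Type*} [NormedAddCommGroup E] [NormedSpace ℝ E]
    {f : E → ℝ} {s : Set E} {x : E} (hx : x ∈ s) (hf : ContDiffWithinAt ℝ 2 f s x) :
    ∃ u ∈ nhdsWithin x s, ∃ (f' : E → E →L[ℝ] ℝ) (f'' : E → E →L[ℝ] E →L[ℝ] ℝ),
      (∀ y ∈ u, HasFDerivWithinAt f (f' y) s y) ∧ (∀ y ∈ u, HasFDerivWithinAt f' (f'' y) s y) ∧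
      ContinuousWithinAt f'' s x := by
  obtain ⟨u, hu, -, -, f', hf', hc⟩ := (contDiffWithinAt_succ_iff_hasFDerivWithinAt'
    (n := 1) (by norm_num)).1 (by simpa [one_add_one_eq_two] using hf)
  obtain ⟨v, hv, -, -, f'', hf'', hc'⟩ := (contDiffWithinAt_succ_iff_hasFDerivWithinAt'
    (n := 0) (by norm_num)).1 (by simpa using hc)
  rw [insert_eq_of_mem hx] at hu hv
  exact ⟨u ∩ v, Filter.inter_mem hu hv, f', f'', fun y hy => hf' y hy.1,
    fun y hy => hf'' y hy.2, hc'.continuousWithinAt⟩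

/-- Second derivatives along the coordinate axes of a family that is smooth in all variables. -/
theorem exists_hasDerivAt_axis {Φ : Plane → ℝ × ℝ → ℝ} {z₀ : Plane} {q₀ : ℝ × ℝ} {Q : Set (ℝ × ℝ)}
    {ε : ℝ} (hε : 0 < ε) (hq₀ : q₀ ∈ Q)
    (hΦ : ContDiffOn ℝ 2 (fun p : Plane × (ℝ × ℝ) => Φ p.1 p.2) (Metric.ball z₀ ε ×ˢ Q)) :
    ∃ D₁ D₂ : Fin 2 → Plane → ℝ × ℝ → ℝ, ∃ ρ : ℝ, 0 < ρ ∧ ρ ≤ ε ∧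
      (∀ k, ∀ z ∈ Metric.ball z₀ ρ, ∀ q ∈ Q, dist q q₀ < ρ →
        HasDerivAt (fun t : ℝ => Φ (z + t • axisVec k) q) (D₁ k z q) 0 ∧
        HasDerivAt (fun t : ℝ => D₁ k (z + t • axisVec k) q) (D₂ k z q) 0) ∧
      ∀ k, ContinuousWithinAt (fun p : Plane × (ℝ × ℝ) => D₂ k p.1 p.2)
        (Metric.ball z₀ ε ×ˢ Q) (z₀, q₀) := by
  have hmem : (z₀, q₀) ∈ Metric.ball z₀ ε ×ˢ Q := ⟨Metric.mem_ball_self hε, hq₀⟩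
  obtain ⟨u, hu, f', f'', hf', hf'', hc⟩ := exists_hasFDerivWithinAt_two hmem (hΦ _ hmem)
  obtain ⟨r, hr, hru⟩ := Metric.mem_nhdsWithin_iff.1 hu
  have hball : ∀ z ∈ Metric.ball z₀ (min r ε), ∀ q ∈ Q, dist q q₀ < min r ε →
      (z, q) ∈ u := fun z hz q hq hd => hru ⟨by
    rw [Metric.mem_ball, Prod.dist_eq]
    exact max_lt (hz.trans_le (min_le_left _ _)) (hd.trans_le (min_le_left _ _)),
    Metric.ball_subset_ball (min_le_right _ _) hz, hq⟩
  refine ⟨fun k z q => f' (z, q) (axisVec k, 0), fun k z q =>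
    f'' (z, q) (axisVec k, 0) (axisVec k, 0), min r ε, lt_min hr hε, min_le_right _ _, ?_, ?_⟩
  · intro k z hz q hq hd
    have hU := hball z hz q hq hd
    have hline : HasDerivAt (fun t : ℝ => ((z + t • axisVec k, q) : Plane × (ℝ × ℝ)))
        (axisVec k, 0) 0 := by
      refine HasDerivAt.prodMk ?_ (hasDerivAt_const _ _)
      simpa using ((hasDerivAt_id (0 : ℝ)).smul_const (axisVec k)).const_add z
    have hz' : z ∈ Metric.ball z₀ ε := Metric.ball_subset_ball (min_le_right _ _) hz
    -- Only z moves along the line while q stays fixed in Q, so the line stays in the product near t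
    -- = 0 and the derivative is two-sided.
    have hnear : ∀ᶠ t in nhds (0 : ℝ),
        ((z + t • axisVec k, q) : Plane × (ℝ × ℝ)) ∈ Metric.ball z₀ ε ×ˢ Q := by
      have : ContinuousAt (fun t : ℝ => z + t • axisVec k) 0 := by fun_prop
      filter_upwards [this.preimage_mem_nhds (Metric.isOpen_ball.mem_nhds (by simpa using hz'))]
        with t ht using ⟨ht, hq⟩
    have e0 : (z + (0 : ℝ) • axisVec k, q) = (z, q) := by simp
    constructor
    · exact (hf' _ hU).comp_hasDerivAt_of_eq (0 : ℝ) hline hnear e0.symm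
    · have h3 := (hf'' _ hU).comp_hasDerivAt_of_eq (0 : ℝ) hline hnear e0.symm
      simpa using h3.clm_apply (hasDerivAt_const (0 : ℝ) ((axisVec k, 0) : Plane × (ℝ × ℝ)))
  · intro k
    exact (hc.clm_apply continuousWithinAt_const).clm_apply continuousWithinAt_const

/-! ### Coordinates adapted to a side. -/

/-- The point with inward normal coordinate `x` and tangential coordinate `s`, measured from the
point `z₀` of the side with outward normal `σ • axisVec i`. -/
noncomputable def sidePoint (i j : Fin 2) (σ : ℝ) (z₀ : Plane) (p : ℝ × ℝ) : Plane :=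
  z₀ + (-(σ * p.1)) • axisVec i + p.2 • axisVec j

section sidePoint

variable {i j : Fin 2} {σ : ℝ} {z₀ : Plane}

theorem continuous_sidePoint : Continuous (sidePoint i j σ z₀) := by
  unfold sidePoint; fun_prop

theorem sidePoint_zero : sidePoint i j σ z₀ (0, 0) = z₀ := by simp [sidePoint]

theorem sidePoint_apply_normal (hij : j ≠ i) (p : ℝ × ℝ) :
    sidePoint i j σ z₀ p i = z₀ i - σ * p.1 := by
  simp [sidePoint, axisVec, hij.symm]; ring

theorem sidePoint_apply_tangent (hij : j ≠ i) (p : ℝ × ℝ) :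
    sidePoint i j σ z₀ p j = z₀ j + p.2 := by
  simp [sidePoint, axisVec, hij]

theorem forall_fin_two_of_ne (hij : j ≠ i) {P : Fin 2 → Prop} : (∀ k, P k) ↔ P i ∧ P j := by
  refine ⟨fun h => ⟨h i, h j⟩, fun h k => ?_⟩
  have : k = i ∨ k = j := by omega
  rcases this with rfl | rfl
  exacts [h.1, h.2]

theorem sum_fin_two_of_ne (hij : j ≠ i) (f : Fin 2 → ℝ) : ∑ k, f k = f i + f j := by
  rw [Fin.sum_univ_two]
  fin_cases i <;> fin_cases j <;> simp_all [add_comm]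

theorem sidePoint_coord (hij : j ≠ i) (hσ : σ * σ = 1) (z : Plane) :
    sidePoint i j σ z₀ (σ * (z₀ i - z i), z j - z₀ j) = z := by
  ext k
  revert k
  rw [forall_fin_two_of_ne hij, sidePoint_apply_normal hij, sidePoint_apply_tangent hij]
  constructor
  · linear_combination (z i - z₀ i) * hσ
  · simp

theorem sidePoint_mem_ball (hij : j ≠ i) (hσ : σ * σ = 1) {ε : ℝ} (hε : 0 < ε) (p : ℝ × ℝ) :
    sidePoint i j σ z₀ p ∈ Metric.ball z₀ ε ↔ p.1 ^ 2 + p.2 ^ 2 < ε ^ 2 := by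
  rw [Metric.mem_ball, EuclideanSpace.dist_eq, sum_fin_two_of_ne hij, Real.sqrt_lt' hε,
    Real.dist_eq, Real.dist_eq, sq_abs, sq_abs, sidePoint_apply_normal hij,
    sidePoint_apply_tangent hij]
  have : (z₀ i - σ * p.1 - z₀ i) ^ 2 = p.1 ^ 2 := by linear_combination p.1 ^ 2 * hσ
  rw [this, add_sub_cancel_left]

theorem sidePoint_mem_openSide (hij : j ≠ i) (hz₀ : z₀ ∈ openSide i σ) {s : ℝ}
    (hs : z₀ j + s ∈ Ioo (-(π / 2)) (π / 2)) : sidePoint i j σ z₀ (0, s) ∈ openSide i σ := by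
  refine ⟨by simp [sidePoint_apply_normal hij, hz₀.1], fun k hk => ?_⟩
  obtain rfl : k = j := by omega
  rwa [sidePoint_apply_tangent hij]

theorem sidePoint_mem_inter_openSquare (hij : j ≠ i) (hσ : σ = 1 ∨ σ = -1)
    (hz₀ : z₀ ∈ openSide i σ) {ε : ℝ} (hε : 0 < ε) (hε1 : ε ≤ 1)
    (hε2 : ∀ s : ℝ, s ^ 2 < ε ^ 2 → z₀ j + s ∈ Ioo (-(π / 2)) (π / 2)) (p : ℝ × ℝ) :
    sidePoint i j σ z₀ p ∈ Metric.ball z₀ ε ∩ openSquare ↔ p ∈ halfDisc ε := by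
  have hσσ : σ * σ = 1 := by rcases hσ with rfl | rfl <;> norm_num
  rw [mem_inter_iff, sidePoint_mem_ball hij hσσ hε, openSquare, mem_ofPred_eq,
    forall_fin_two_of_ne hij, sidePoint_apply_normal hij, sidePoint_apply_tangent hij, hz₀.1,
    halfDisc, mem_ofPred_eq]
  have hpi := Real.pi_gt_three
  constructor
  · rintro ⟨h1, h2, -⟩
    refine ⟨?_, h1⟩
    rcases hσ with rfl | rfl
    · linarith [h2.2]
    · linarith [h2.1]
  · rintro ⟨h1, h2⟩
    -- Since ε ≤ 1 < π, the opposite side of the square is out of reach.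
    have h3 : p.1 < ε := lt_of_pow_lt_pow_left₀ 2 hε.le (by nlinarith [sq_nonneg p.2])
    refine ⟨h2, ?_, hε2 _ (by nlinarith [sq_nonneg p.1])⟩
    rcases hσ with rfl | rfl <;> constructor <;> linarith

theorem hasDerivAt_sidePoint_normal {f : Plane → ℝ} {x s d : ℝ}
    (h : HasDerivAt (fun t : ℝ => f (sidePoint i j σ z₀ (x, s) + t • axisVec i)) d 0) :
    HasDerivAt (fun y : ℝ => f (sidePoint i j σ z₀ (y, s))) (-σ * d) x := by
  have h1 : HasDerivAt (fun y : ℝ => -σ * (y - x)) (-σ) x := by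
    simpa using ((hasDerivAt_id x).sub_const x).const_mul (-σ)
  have h2 := h.comp_of_eq x h1 (by simp)
  rw [mul_comm]
  refine h2.congr_of_eventuallyEq (.of_forall fun y => ?_)
  simp only [Function.comp_apply, sidePoint]
  congr 1
  module

theorem hasDerivAt_sidePoint_tangent {f : Plane → ℝ} {x s d : ℝ}
    (h : HasDerivAt (fun t : ℝ => f (sidePoint i j σ z₀ (x, s) + t • axisVec j)) d 0) :
    HasDerivAt (fun t : ℝ => f (sidePoint i j σ z₀ (x, t))) d s := by
  have h1 : HasDerivAt (fun t : ℝ => t - s) 1 s := (hasDerivAt_id s).sub_const s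
  have h2 := h.comp_of_eq s h1 (by simp)
  rw [mul_one] at h2
  refine h2.congr_of_eventuallyEq (.of_forall fun y => ?_)
  simp only [Function.comp_apply, sidePoint]
  congr 1
  module

end sidePoint

/-- On a side, the Robin condition gives the two-sided normal derivative of a function that is
differentiable across the side. -/
theorem RobinCondition.normal_deriv {h : ℝ} {f : Plane → ℝ} (hf : RobinCondition h f) {i : Fin 2}
    {σ : ℝ} (hσ : σ = 1 ∨ σ = -1) {z : Plane} (hz : z ∈ openSide i σ) {d : ℝ}
    (hd : HasDerivAt (fun t : ℝ => f (z + t • axisVec i)) d 0) : σ * d + h * f z = 0 := by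
  have h1 := hf i σ hσ z hz
  have hpi := Real.pi_gt_three
  have h2 : HasDerivAt (fun t : ℝ => f (z + t • (σ • axisVec i))) (σ * d) 0 := by
    have h3 : HasDerivAt (fun t : ℝ => t * σ) σ 0 := by
      simpa using (hasDerivAt_id (0 : ℝ)).mul_const σ
    have h4 := hd.comp_of_eq 0 h3 (by simp)
    rw [mul_comm]
    refine h4.congr_of_eventuallyEq (.of_forall fun t => ?_)
    simp [smul_smul]
  -- A unit segment going inward fits in the square, whose width is π > 3; it makes the one-sided
  -- derivative unique, hence equal to the two-sided one.
  have hsub : Icc (-1 : ℝ) 0 ⊆ (fun t : ℝ => z + t • (σ • axisVec i)) ⁻¹' closedSquare := by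
    intro t ht k
    by_cases hk : k = i
    · subst hk
      simp only [PiLp.add_apply, PiLp.smul_apply, axisVec, PiLp.single_apply, hz.1,
        if_true, smul_eq_mul]
      rcases hσ with rfl | rfl <;> constructor <;> linarith [ht.1, ht.2]
    · have := hz.2 k hk
      simp only [PiLp.add_apply, PiLp.smul_apply, axisVec, PiLp.single_apply, hk,
        if_false, smul_eq_mul, mul_zero, add_zero]
      exact Ioo_subset_Icc_self this
  have hu : UniqueDiffWithinAt ℝ ((fun t : ℝ => z + t • (σ • axisVec i)) ⁻¹' closedSquare) 0 :=
    ((uniqueDiffOn_Icc (by norm_num : (-1 : ℝ) < 0)) 0 (by simp)).mono hsub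
  rwa [lineDerivWithin, h2.hasDerivWithinAt.derivWithin hu] at h1

/-! ### The local picture for nearby parameters. -/

/-- Near a saddle point on the side `x = 0`, with a Robin condition there, the nodal set of every
member of the family in a half-disc consists of three connected pieces (some possibly empty). -/
theorem exists_isPreconnected_pieces {G : ℝ × ℝ → ℝ → ℝ → ℝ} {Q : Set (ℝ × ℝ)} {q₀ : ℝ × ℝ}
    {ρ ε : ℝ} (hε : 0 < ε) (hερ : ε < ρ) (hq₀ : q₀ ∈ Q) (h0 : G q₀ 0 0 = 0)
    (hd0 : HasDerivAt (fun s => G q₀ 0 s) 0 0)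
    (hc : ContinuousOn (fun p : (ℝ × ℝ) × (ℝ × ℝ) => G p.2 p.1.1 p.1.2)
      ({p | p.1 ^ 2 + p.2 ^ 2 < ρ ^ 2} ×ˢ Q))
    (hQ : ∀ q ∈ Q, 0 ≤ q.2)
    (hconc : ∀ q ∈ Q, dist q q₀ < ρ → ∀ s,
      StrictConcaveOn ℝ {x : ℝ | x ^ 2 + s ^ 2 < ρ ^ 2} (fun x => G q x s))
    (hconv : ∀ q ∈ Q, dist q q₀ < ρ → ∀ x,
      StrictConvexOn ℝ {s : ℝ | s ^ 2 + x ^ 2 < ρ ^ 2} (fun s => G q x s))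
    (hrob : ∀ q ∈ Q, dist q q₀ < ρ → ∀ s : ℝ, s ^ 2 < ρ ^ 2 →
      HasDerivAt (fun x => G q x s) (q.2 * G q 0 s) 0) :
    (∀ x, 0 < x → x < ρ → G q₀ x 0 < 0) ∧ (∀ s : ℝ, s ^ 2 < ρ ^ 2 → s ≠ 0 → 0 < G q₀ 0 s) ∧
    ∃ η, 0 < η ∧ ∀ q ∈ Q, dist q q₀ < η → ∃ b,
      IsPreconnected {p ∈ halfDisc ε | G q p.1 p.2 < 0} ∧
      IsPreconnected {p ∈ halfDisc ε | 0 < G q p.1 p.2 ∧ p.2 ∈ Iio b} ∧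
      IsPreconnected {p ∈ halfDisc ε | 0 < G q p.1 p.2 ∧ p.2 ∈ Ioi b} ∧
      (∀ p ∈ halfDisc ε, 0 < G q p.1 p.2 → p.2 ≠ b) ∧ (q = q₀ → b = 0) := by
  have hρ : 0 < ρ := hε.trans hερ
  have hερ2 : ε ^ 2 < ρ ^ 2 := by nlinarith
  have hV : ∀ q ∈ Q, dist q q₀ < ρ → ∀ s x y, 0 ≤ x → x < y → y ^ 2 + s ^ 2 < ρ ^ 2 →
      G q x s ≤ 0 → G q y s < 0 := by
    intro q hq hd s x y hx hxy hy hneg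
    have hs : s ^ 2 < ρ ^ 2 := by nlinarith [sq_nonneg y]
    refine neg_of_strictConcaveOn_of_robin (hconc q hq hd s) (hQ q hq) (hrob q hq hd s hs)
      ?_ hy hx hxy hneg
    show (0 : ℝ) ^ 2 + s ^ 2 < ρ ^ 2
    linarith
  have hH : ∀ q ∈ Q, dist q q₀ < ρ → ∀ x s t u, x ^ 2 + s ^ 2 < ρ ^ 2 → x ^ 2 + t ^ 2 < ρ ^ 2 →
      u ∈ uIcc s t → G q x u ≤ max (G q x s) (G q x t) := by
    intro q hq hd x s t u hs ht hu
    refine (hconv q hq hd x).convexOn.le_on_segment (x := s) (y := t) ?_ ?_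
      (by rwa [segment_eq_uIcc])
    · rw [mem_ofPred_eq]; linarith
    · rw [mem_ofPred_eq]; linarith
  have hdd : dist q₀ q₀ < ρ := by simpa using hρ
  have hbneg : ∀ x, 0 < x → x < ρ → G q₀ x 0 < 0 := fun x hx hxρ =>
    hV q₀ hq₀ hdd 0 0 x le_rfl hx (by nlinarith) h0.le
  have hbpos : ∀ s : ℝ, s ^ 2 < ρ ^ 2 → s ≠ 0 → 0 < G q₀ 0 s := by
    intro s hs hs0
    refine pos_of_strictConvexOn_of_hasDerivAt_zero (hconv q₀ hq₀ hdd 0) ?_ h0 hd0 ?_ hs0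
    · rw [mem_ofPred_eq]; nlinarith
    · rw [mem_ofPred_eq]; linarith
  refine ⟨hbneg, hbpos, ?_⟩
  -- The barriers at s = ±ε/2: the strict inequality G(0, 0) = 0 < G(0, c) at the base parameters
  -- persists for small x and nearby q by continuity.
  have hbar : ∀ c : ℝ, c ^ 2 = (ε / 2) ^ 2 → ∃ r, 0 < r ∧ ∀ q ∈ Q, dist q q₀ < r →
      ∀ x ∈ Ico 0 r, G q x 0 < G q x c := by
    intro c hc2
    have hcρ : c ^ 2 < ρ ^ 2 := by nlinarith
    have hat : ∀ d : ℝ, d ^ 2 ≤ c ^ 2 → ContinuousWithinAt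
        (fun p : ℝ × (ℝ × ℝ) => G p.2 p.1 d) ({x | x ^ 2 + c ^ 2 < ρ ^ 2} ×ˢ Q) (0, q₀) := by
      intro d hdc
      have := hc ((0, d), q₀) ⟨by simp only [mem_ofPred_eq]; linarith, hq₀⟩
      refine ContinuousWithinAt.comp (f := fun p : ℝ × (ℝ × ℝ) => ((p.1, d), p.2))
        (x := ((0 : ℝ), q₀)) this (by fun_prop) ?_
      rintro ⟨x, q⟩ ⟨hx, hq⟩
      simp only [mem_ofPred_eq] at hx
      exact ⟨by simp only [mem_ofPred_eq]; linarith, hq⟩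
    have hlt := (hat 0 (by simpa using sq_nonneg c)).eventually_lt (hat c le_rfl)
      (show G q₀ 0 0 < G q₀ 0 c by
        rw [h0]; exact hbpos c hcρ (by rintro rfl; nlinarith))
    obtain ⟨r, hr, hsub⟩ := Metric.mem_nhdsWithin_iff.1 hlt
    refine ⟨min r (ε / 2), lt_min hr (by linarith), fun q hq hd x hx => ?_⟩
    have hxr := hx.2.trans_le (min_le_left _ _)
    have hxε := hx.2.trans_le (min_le_right _ _)
    refine hsub (a := (x, q)) ⟨?_, ?_, hq⟩
    · rw [Metric.mem_ball, Prod.dist_eq]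
      refine max_lt ?_ (hd.trans_le (min_le_left _ _))
      simpa [Real.dist_eq, abs_of_nonneg hx.1] using hxr
    · simp only [mem_ofPred_eq]; nlinarith [hx.1]
  obtain ⟨r₁, hr₁, hbar₁⟩ := hbar (ε / 2) rfl
  obtain ⟨r₂, hr₂, hbar₂⟩ := hbar (-(ε / 2)) (by ring)
  obtain ⟨κ, hκ, hκ1, hκ2, hκε⟩ : ∃ κ, 0 < κ ∧ κ < r₁ ∧ κ < r₂ ∧ κ ≤ ε / 2 := by
    have hm : 0 < min (min r₁ r₂) ε := lt_min (lt_min hr₁ hr₂) hε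
    have h1 : min (min r₁ r₂) ε ≤ r₁ := (min_le_left _ _).trans (min_le_left _ _)
    have h2 : min (min r₁ r₂) ε ≤ r₂ := (min_le_left _ _).trans (min_le_right _ _)
    have h3 : min (min r₁ r₂) ε ≤ ε := min_le_right _ _
    exact ⟨min (min r₁ r₂) ε / 2, by linarith, by linarith, by linarith, by linarith⟩
  obtain ⟨r₃, hr₃, hκneg⟩ : ∃ r, 0 < r ∧ ∀ q ∈ Q, dist q q₀ < r → G q κ 0 < 0 := by
    have hcκ : ContinuousWithinAt (fun q => G q κ 0) Q q₀ := by
      have hκmem : κ ^ 2 + (0 : ℝ) ^ 2 < ρ ^ 2 := by nlinarith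
      refine ContinuousWithinAt.comp (f := fun q : ℝ × ℝ => ((κ, (0 : ℝ)), q))
        (x := q₀) (hc ((κ, 0), q₀) ⟨hκmem, hq₀⟩) (by fun_prop) ?_
      exact fun q hq => ⟨hκmem, hq⟩
    obtain ⟨r, hr, hsub⟩ := Metric.mem_nhdsWithin_iff.1
      (hcκ.eventually_lt continuousWithinAt_const (hbneg κ hκ (by linarith)))
    exact ⟨r, hr, fun q hq hd => hsub ⟨hd, hq⟩⟩
  refine ⟨min (min r₁ r₂) (min r₃ ρ), lt_min (lt_min hr₁ hr₂) (lt_min hr₃ hρ),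
    fun q hq hd => ?_⟩
  have hd1 : dist q q₀ < r₁ := hd.trans_le ((min_le_left _ _).trans (min_le_left _ _))
  have hd2 : dist q q₀ < r₂ := hd.trans_le ((min_le_left _ _).trans (min_le_right _ _))
  have hd3 : dist q q₀ < r₃ := hd.trans_le ((min_le_right _ _).trans (min_le_left _ _))
  have hdρ : dist q q₀ < ρ := hd.trans_le ((min_le_right _ _).trans (min_le_right _ _))
  have hVε : ∀ s x y, 0 ≤ x → x < y → y ^ 2 + s ^ 2 < ε ^ 2 → G q x s ≤ 0 → G q y s < 0 :=
    fun s x y hx hxy hy => hV q hq hdρ s x y hx hxy (hy.trans hερ2)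
  have hHε : ∀ x s t u, x ^ 2 + s ^ 2 < ε ^ 2 → x ^ 2 + t ^ 2 < ε ^ 2 → u ∈ uIcc s t →
      G q x u ≤ max (G q x s) (G q x t) :=
    fun x s t u hs ht => hH q hq hdρ x s t u (hs.trans hερ2) (ht.trans hερ2)
  have hN : IsPreconnected {p ∈ halfDisc ε | G q p.1 p.2 < 0} :=
    isPreconnected_neg hκ hκε hVε (fun x s t u _ => hHε x s t u) (hκneg q hq hd3)
      (fun x hx => hbar₁ q hq hd1 x ⟨hx.1, hx.2.trans_lt hκ1⟩)
      (fun x hx => hbar₂ q hq hd2 x ⟨hx.1, hx.2.trans_lt hκ2⟩)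
  have hcq : ContinuousOn (fun p : ℝ × ℝ => G q p.1 p.2) {p | p.1 ^ 2 + p.2 ^ 2 < ε ^ 2} := by
    refine hc.comp (f := fun p : ℝ × ℝ => (p, q)) (by fun_prop) ?_
    exact fun p hp => ⟨lt_trans hp hερ2, hq⟩
  have hpos0 : ∀ p ∈ halfDisc ε, 0 < G q p.1 p.2 → 0 < G q 0 p.2 := by
    rintro ⟨x, s⟩ ⟨hx, hd⟩ hpos
    by_contra h
    exact absurd (hVε s 0 x le_rfl hx hd (not_lt.1 h)) (not_lt.2 hpos.le)
  -- A boundary point b with G ≤ 0 bars positive points from the whole line s = b. By convexity, a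
  -- positive trace value on one side of b stays positive moving away from b.
  have hsplit : ∀ b : ℝ, b ^ 2 < ε ^ 2 → G q 0 b ≤ 0 →
      IsPreconnected {p ∈ halfDisc ε | 0 < G q p.1 p.2 ∧ p.2 ∈ Iio b} ∧
      IsPreconnected {p ∈ halfDisc ε | 0 < G q p.1 p.2 ∧ p.2 ∈ Ioi b} ∧
      (∀ p ∈ halfDisc ε, 0 < G q p.1 p.2 → p.2 ≠ b) := by
    intro b hb hGb
    have hpos : ∀ u m : ℝ, u ^ 2 < ε ^ 2 → m ∈ uIcc u b → 0 < G q 0 m → 0 < G q 0 u := by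
      intro u m hu hm hGm
      by_contra hGu
      have := hHε 0 u b m (by linarith) (by linarith) hm
      exact absurd (this.trans (max_le (not_lt.1 hGu) hGb)) (not_le.2 hGm)
    refine ⟨isPreconnected_pos hcq hVε ordConnected_Iio ?_,
      isPreconnected_pos hcq hVε ordConnected_Ioi ?_, ?_⟩
    · intro s hs t ht hsε htε hGs hGt u hu
      have huε := sq_lt_of_mem_uIcc hsε htε hu
      rcases mem_uIcc.1 hu with h | h
      · exact hpos u t huε (mem_uIcc.2 (Or.inl ⟨h.2, le_of_lt ht⟩)) hGt
      · exact hpos u s huε (mem_uIcc.2 (Or.inl ⟨h.2, le_of_lt hs⟩)) hGs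
    · intro s hs t ht hsε htε hGs hGt u hu
      have huε := sq_lt_of_mem_uIcc hsε htε hu
      rcases mem_uIcc.1 hu with h | h
      · exact hpos u s huε (mem_uIcc.2 (Or.inr ⟨le_of_lt hs, h.1⟩)) hGs
      · exact hpos u t huε (mem_uIcc.2 (Or.inr ⟨le_of_lt ht, h.1⟩)) hGt
    · rintro p hp hGp rfl
      exact absurd (hpos0 p hp hGp) (not_lt.2 hGb)
  -- The cut 0 is preferred, which ensures b = 0 at q₀.
  by_cases hb0 : G q 0 0 ≤ 0
  · obtain ⟨h1, h2, h3⟩ := hsplit 0 (by nlinarith) hb0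
    exact ⟨0, hN, h1, h2, h3, fun _ => rfl⟩
  have hne : q ≠ q₀ := by rintro rfl; exact hb0 h0.le
  by_cases hb : ∃ b : ℝ, b ^ 2 < ε ^ 2 ∧ G q 0 b ≤ 0
  · obtain ⟨b, hb, hGb⟩ := hb
    obtain ⟨h1, h2, h3⟩ := hsplit b hb hGb
    exact ⟨b, hN, h1, h2, h3, fun h => absurd h hne⟩
  · push Not at hb
    have hI : ∀ I : Set ℝ, ∀ s ∈ I, ∀ t ∈ I, s ^ 2 < ε ^ 2 → t ^ 2 < ε ^ 2 → 0 < G q 0 s →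
        0 < G q 0 t → ∀ u ∈ uIcc s t, 0 < G q 0 u :=
      fun I s _ t _ hs ht _ _ u hu => hb u (sq_lt_of_mem_uIcc hs ht hu)
    -- The trace is positive throughout, so no cut is needed: s = ε misses the half-disc and the
    -- piece beyond it is empty.
    refine ⟨ε, hN, isPreconnected_pos hcq hVε ordConnected_Iio (hI _),
      isPreconnected_pos hcq hVε ordConnected_Ioi (hI _), ?_, fun h => absurd h hne⟩
    rintro p ⟨-, hp⟩ - he
    rw [he] at hp
    nlinarith [sq_nonneg p.1]

/-! ### Transfer to the plane and conclusion. -/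

theorem hasDerivAt_line_shift {f : Plane → ℝ} {z v : Plane} {d t : ℝ}
    (h : HasDerivAt (fun u : ℝ => f (z + t • v + u • v)) d 0) :
    HasDerivAt (fun u : ℝ => f (z + u • v)) d t := by
  have h2 := h.comp_of_eq t ((hasDerivAt_id t).sub_const t) (by simp)
  rw [mul_one] at h2
  refine h2.congr_of_eventuallyEq (.of_forall fun y => ?_)
  simp only [Function.comp_apply, id]
  congr 1
  module

/-- `sidePoint` as a homeomorphism onto the plane. -/
noncomputable def sideHomeomorph {i j : Fin 2} (hij : j ≠ i) {σ : ℝ} (hσ : σ * σ = 1)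
    (z₀ : Plane) : ℝ × ℝ ≃ₜ Plane where
  toFun := sidePoint i j σ z₀
  invFun z := (σ * (z₀ i - z i), z j - z₀ j)
  left_inv p := by
    ext
    · simp only [sidePoint_apply_normal hij]
      linear_combination p.1 * hσ
    · simp [sidePoint_apply_tangent hij]
  right_inv z := sidePoint_coord hij hσ z
  continuous_toFun := continuous_sidePoint
  continuous_invFun := by fun_prop

theorem isOpen_halfDisc (ε : ℝ) : IsOpen (halfDisc ε) :=
  (isOpen_lt continuous_const continuous_fst).inter
    (isOpen_lt (f := fun p : ℝ × ℝ => p.1 ^ 2 + p.2 ^ 2) (by fun_prop) continuous_const)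

/-- The nodal set in the half-disc, cut along the line `s = b`, in the coordinates of the side. -/
theorem nodalSet_eq_union {i j : Fin 2} (hij : j ≠ i) {σ : ℝ} (hσ : σ = 1 ∨ σ = -1) {z₀ : Plane}
    (hz₀ : z₀ ∈ openSide i σ) {ε : ℝ} (hε : 0 < ε) (hε1 : ε ≤ 1)
    (hε2 : ∀ s : ℝ, s ^ 2 < ε ^ 2 → z₀ j + s ∈ Ioo (-(π / 2)) (π / 2)) {f : Plane → ℝ} {a : ℝ}
    (ha : a ≠ 0) {b : ℝ}
    (hb : ∀ p ∈ halfDisc ε, 0 < a * f (sidePoint i j σ z₀ p) → p.2 ≠ b) :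
    {w ∈ Metric.ball z₀ ε ∩ openSquare | f w ≠ 0} =
      sidePoint i j σ z₀ '' {p ∈ halfDisc ε | a * f (sidePoint i j σ z₀ p) < 0} ∪
      (sidePoint i j σ z₀ '' {p ∈ halfDisc ε | 0 < a * f (sidePoint i j σ z₀ p) ∧ p.2 ∈ Iio b} ∪
       sidePoint i j σ z₀ '' {p ∈ halfDisc ε | 0 < a * f (sidePoint i j σ z₀ p) ∧ p.2 ∈ Ioi b}) := by
  have hσσ : σ * σ = 1 := by rcases hσ with rfl | rfl <;> norm_num
  have hmem := sidePoint_mem_inter_openSquare hij hσ hz₀ hε hε1 hε2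
  rw [← image_union, ← image_union]
  ext w
  constructor
  · rintro ⟨hw, hfw⟩
    have hc := sidePoint_coord (z₀ := z₀) hij hσσ w
    set p : ℝ × ℝ := (σ * (z₀ i - w i), w j - z₀ j)
    refine ⟨p, ?_, hc⟩
    rw [← hc] at hw hfw
    have hp := (hmem p).1 hw
    rcases (mul_ne_zero ha hfw).lt_or_gt with h | h
    · exact Or.inl ⟨hp, h⟩
    · rcases (hb p hp h).lt_or_gt with h' | h'
      · exact Or.inr (Or.inl ⟨hp, h, h'⟩)
      · exact Or.inr (Or.inr ⟨hp, h, h'⟩)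
  · rintro ⟨p, hp | hp | hp, rfl⟩
    · exact ⟨(hmem p).2 hp.1, (mul_ne_zero_iff.1 hp.2.ne).2⟩
    · exact ⟨(hmem p).2 hp.1, (mul_ne_zero_iff.1 hp.2.1.ne').2⟩
    · exact ⟨(hmem p).2 hp.1, (mul_ne_zero_iff.1 hp.2.1.ne').2⟩

theorem mainTheorem5
    (Θ : Set ℝ) (hΘ : IsOpen Θ) (h₀ : ℝ) (hh₀ : 0 < h₀) (ev : ℝ → ℝ)
    (Φ : Plane → ℝ → ℝ → ℝ)
    -- a smooth family of Robin eigenfunctions on the square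
    (hΦ : IsSmoothRobinFamily Θ h₀ ev Φ)
    -- a non-corner point on one side; `i` is the normal and `j` the tangential coordinate
    (i j : Fin 2) (hij : j ≠ i) (σ : ℝ) (hσ : σ = 1 ∨ σ = -1)
    (z₀ : Plane) (hz₀ : z₀ ∈ openSide i σ)
    (θ₀ : ℝ) (hθ₀ : θ₀ ∈ Θ)
    -- conditions at `z₀` for the parameters `(θ₀, 0)`
    (hzero : Φ z₀ θ₀ 0 = 0)
    (htan : deriv (fun t : ℝ => Φ (z₀ + t • axisVec j) θ₀ 0) 0 = 0)
    (htan2 : iteratedDeriv 2 (fun t : ℝ => Φ (z₀ + t • axisVec j) θ₀ 0) 0 ≠ 0)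
    (hpar : deriv (fun θ : ℝ => Φ z₀ θ 0) θ₀ ≠ 0)
    -- near `z₀` the family is smooth and solves the equation on a full disc of the plane
    (ε₁ : ℝ) (hε₁ : 0 < ε₁) (η₁ : ℝ) (hη₁ : 0 < η₁)
    (hsmooth : ContDiffOn ℝ ∞ (fun p : Plane × ℝ × ℝ => Φ p.1 p.2.1 p.2.2)
      (Metric.ball z₀ ε₁ ×ˢ {q : ℝ × ℝ | q.1 ∈ Θ ∧ q.2 ∈ Ico 0 h₀ ∧ |q.1 - θ₀| + q.2 ≤ η₁}))
    (heq : ∀ θ ∈ Θ, ∀ h ∈ Ico 0 h₀, |θ - θ₀| + h ≤ η₁ → ∀ z ∈ Metric.ball z₀ ε₁,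
      -(Δ (fun w => Φ w θ h) z) = ev h * Φ z θ h) :
    ∃ ε₀ : ℝ, 0 < ε₀ ∧ ε₀ < ε₁ ∧ ∃ η₀ : ℝ, 0 < η₀ ∧ η₀ < η₁ ∧
      (nodalDomains (fun z => Φ z θ₀ 0) (Metric.ball z₀ ε₀ ∩ openSquare)).encard = 3 ∧
      ∀ θ ∈ Θ, ∀ h ∈ Ico 0 h₀, |θ - θ₀| + h ≤ η₀ →
        (nodalDomains (fun z => Φ z θ h) (Metric.ball z₀ ε₀ ∩ openSquare)).encard ≤ 3 := by
  have hσσ : σ * σ = 1 := by rcases hσ with rfl | rfl <;> norm_num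
  set Q : Set (ℝ × ℝ) := {q : ℝ × ℝ | q.1 ∈ Θ ∧ q.2 ∈ Ico 0 h₀ ∧ |q.1 - θ₀| + q.2 ≤ η₁}
  set q₀ : ℝ × ℝ := (θ₀, 0) with hq₀def
  have hq₀ : q₀ ∈ Q := ⟨hθ₀, ⟨le_rfl, hh₀⟩, by simpa [hq₀def] using hη₁.le⟩
  have hsm2 : ContDiffOn ℝ 2 (fun p : Plane × (ℝ × ℝ) => Φ p.1 p.2.1 p.2.2)
      (Metric.ball z₀ ε₁ ×ˢ Q) := hsmooth.of_le ENat.LEInfty.out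
  obtain ⟨D₁, D₂, ρ₁, hρ₁, hρ₁ε, hD, hD₂c⟩ := exists_hasDerivAt_axis
    (Φ := fun z q => Φ z q.1 q.2) hε₁ hq₀ hsm2
  have hqq : dist q₀ q₀ < ρ₁ := by simpa using hρ₁
  have hz₀ρ : z₀ ∈ Metric.ball z₀ ρ₁ := Metric.mem_ball_self hρ₁
  -- the second derivatives at the base point
  have hbase2 : ∀ k, iteratedDeriv 2 (fun t : ℝ => Φ (z₀ + t • axisVec k) θ₀ 0) 0 =
      D₂ k z₀ q₀ := by
    intro k
    have hnear : ∀ᶠ t in nhds (0 : ℝ), z₀ + t • axisVec k ∈ Metric.ball z₀ ρ₁ := by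
      have : ContinuousAt (fun t : ℝ => z₀ + t • axisVec k) 0 := by fun_prop
      exact this.preimage_mem_nhds (Metric.isOpen_ball.mem_nhds (by simpa using hρ₁))
    have he : deriv (fun t : ℝ => Φ (z₀ + t • axisVec k) θ₀ 0) =ᶠ[nhds 0]
        fun t : ℝ => D₁ k (z₀ + t • axisVec k) q₀ := by
      filter_upwards [hnear] with t ht
      exact (hasDerivAt_line_shift (f := fun w => Φ w θ₀ 0) (hD k _ ht q₀ hq₀ hqq).1).deriv
    rw [iteratedDeriv_succ, iteratedDeriv_one, he.deriv_eq]
    exact (hD k z₀ hz₀ρ q₀ hq₀ hqq).2.deriv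
  have hD₁j : D₁ j z₀ q₀ = 0 := by rw [← (hD j z₀ hz₀ρ q₀ hq₀ hqq).1.deriv]; exact htan
  set a := D₂ j z₀ q₀ with ha_def
  have ha : a ≠ 0 := by rw [ha_def, ← hbase2 j]; exact htan2
  -- The only use of the eigenvalue equation: at a zero of Φ the Laplacian vanishes, so the two
  -- axial second derivatives cancel.
  have hai : D₂ i z₀ q₀ = -a := by
    have hcd : ContDiffAt ℝ 2 (fun w => Φ w θ₀ 0) z₀ := by
      have h1 : ContDiffOn ℝ 2 (fun w : Plane => Φ w θ₀ 0) (Metric.ball z₀ ε₁) :=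
        hsm2.comp (f := fun w : Plane => (w, q₀)) (by fun_prop) fun w hw => ⟨hw, hq₀⟩
      exact h1.contDiffAt (Metric.ball_mem_nhds z₀ hε₁)
    have h2 := heq θ₀ hθ₀ 0 hq₀.2.1 hq₀.2.2 z₀ (Metric.mem_ball_self hε₁)
    rw [laplacian_eq_sum_iteratedDeriv hcd, hzero, sum_fin_two_of_ne hij, hbase2, hbase2] at h2
    linarith
  -- the radius on which the second derivatives keep their signs
  have hsgn : ∀ᶠ p in nhdsWithin (z₀, q₀) (Metric.ball z₀ ε₁ ×ˢ Q),
      0 < a * D₂ j p.1 p.2 ∧ a * D₂ i p.1 p.2 < 0 := by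
    have hpos : 0 < a * a := mul_self_pos.2 ha
    have e1 := continuousWithinAt_const.eventually_lt
      ((continuousWithinAt_const (b := a)).mul (hD₂c j)) hpos
    have e2 := ((continuousWithinAt_const (b := a)).mul (hD₂c i)).eventually_lt
      (continuousWithinAt_const (b := (0 : ℝ))) (by show a * D₂ i z₀ q₀ < 0; rw [hai]; linarith)
    exact e1.and e2
  obtain ⟨r, hr, hrsub⟩ := Metric.mem_nhdsWithin_iff.1 hsgn
  have hz₀j := hz₀.2 j hij
  -- The bound 1 keeps the disc off the opposite side, and the last two bounds keep it away from the
  -- corners.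
  obtain ⟨ρ, hρ, hρ1, hρr, hρone, hρa, hρb⟩ : ∃ ρ, 0 < ρ ∧ ρ ≤ ρ₁ ∧ ρ ≤ r ∧ ρ ≤ 1 ∧
      ρ ≤ π / 2 - z₀ j ∧ ρ ≤ z₀ j + π / 2 := by
    refine ⟨min (min ρ₁ r) (min 1 (min (π / 2 - z₀ j) (z₀ j + π / 2))), ?_, ?_⟩
    · exact lt_min (lt_min hρ₁ hr) (lt_min one_pos (lt_min (by linarith [hz₀j.2])
        (by linarith [hz₀j.1])))
    · simp
  have htangent : ∀ s : ℝ, s ^ 2 < ρ ^ 2 → z₀ j + s ∈ Ioo (-(π / 2)) (π / 2) := by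
    intro s hs
    obtain ⟨h1, h2⟩ := abs_lt.1 (abs_lt_of_sq_lt_sq hs hρ.le)
    constructor <;> linarith
  have hDρ : ∀ k, ∀ p : ℝ × ℝ, p.1 ^ 2 + p.2 ^ 2 < ρ ^ 2 → ∀ q ∈ Q, dist q q₀ < ρ → _ :=
    fun k p hp q hq hd => hD k (sidePoint i j σ z₀ p)
      (Metric.ball_subset_ball hρ1 ((sidePoint_mem_ball hij hσσ hρ p).2 hp)) q hq
      (hd.trans_le hρ1)
  have hsign : ∀ p : ℝ × ℝ, p.1 ^ 2 + p.2 ^ 2 < ρ ^ 2 → ∀ q ∈ Q, dist q q₀ < ρ →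
      0 < a * D₂ j (sidePoint i j σ z₀ p) q ∧ a * D₂ i (sidePoint i j σ z₀ p) q < 0 := by
    intro p hp q hq hd
    have hb := (sidePoint_mem_ball (z₀ := z₀) hij hσσ hρ p).2 hp
    refine hrsub (a := (sidePoint i j σ z₀ p, q)) ⟨?_,
      Metric.ball_subset_ball (hρ1.trans hρ₁ε) hb, hq⟩
    rw [Metric.mem_ball, Prod.dist_eq]
    exact max_lt (lt_of_lt_of_le hb hρr) (hd.trans_le hρr)
  -- The factor a fixes the signs: G is convex in s and concave in x whatever the sign of a.
  set G : ℝ × ℝ → ℝ → ℝ → ℝ := fun q x s => a * Φ (sidePoint i j σ z₀ (x, s)) q.1 q.2 with hG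
  have hGc : ContinuousOn (fun p : (ℝ × ℝ) × (ℝ × ℝ) => G p.2 p.1.1 p.1.2)
      ({p | p.1 ^ 2 + p.2 ^ 2 < ρ ^ 2} ×ˢ Q) := by
    refine continuousOn_const.mul (hsm2.continuousOn.comp
      (f := fun p : (ℝ × ℝ) × (ℝ × ℝ) => (sidePoint i j σ z₀ p.1, p.2))
      (by have := continuous_sidePoint (i := i) (j := j) (σ := σ) (z₀ := z₀); fun_prop) ?_)
    exact fun p hp => ⟨Metric.ball_subset_ball (hρ1.trans hρ₁ε)
      ((sidePoint_mem_ball hij hσσ hρ p.1).2 hp.1), hp.2⟩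
  have hconc : ∀ q ∈ Q, dist q q₀ < ρ → ∀ s,
      StrictConcaveOn ℝ {x : ℝ | x ^ 2 + s ^ 2 < ρ ^ 2} (fun x => G q x s) := by
    intro q hq hd s
    rw [← neg_strictConvexOn_iff]
    refine strictConvexOn_of_hasDerivAt_pos (isOpen_sq_add_lt _ _) (convex_sq_add_lt _ _)
      (g' := fun x => -(a * (-σ * D₁ i (sidePoint i j σ z₀ (x, s)) q)))
      (g'' := fun x => -(a * (-σ * (-σ * D₂ i (sidePoint i j σ z₀ (x, s)) q)))) ?_ ?_ ?_
    · intro x hx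
      exact ((hasDerivAt_sidePoint_normal (f := fun w => Φ w q.1 q.2)
        (hDρ i (x, s) hx q hq hd).1).const_mul a).neg
    · intro x hx
      exact (((hasDerivAt_sidePoint_normal (f := fun w => D₁ i w q)
        (hDρ i (x, s) hx q hq hd).2).const_mul (-σ)).const_mul a).neg
    · intro x hx
      have := (hsign (x, s) hx q hq hd).2
      have e : -(a * (-σ * (-σ * D₂ i (sidePoint i j σ z₀ (x, s)) q))) =
          -(a * D₂ i (sidePoint i j σ z₀ (x, s)) q) := by
        linear_combination -(a * D₂ i (sidePoint i j σ z₀ (x, s)) q) * hσσ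
      rw [e]
      linarith
  have hconv : ∀ q ∈ Q, dist q q₀ < ρ → ∀ x,
      StrictConvexOn ℝ {s : ℝ | s ^ 2 + x ^ 2 < ρ ^ 2} (fun s => G q x s) := by
    intro q hq hd x
    have hcomm : ∀ {s : ℝ}, s ∈ {s : ℝ | s ^ 2 + x ^ 2 < ρ ^ 2} → x ^ 2 + s ^ 2 < ρ ^ 2 :=
      fun hs => (add_comm _ _).trans_lt hs
    refine strictConvexOn_of_hasDerivAt_pos (isOpen_sq_add_lt _ _) (convex_sq_add_lt _ _)
      (g' := fun s => a * D₁ j (sidePoint i j σ z₀ (x, s)) q)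
      (g'' := fun s => a * D₂ j (sidePoint i j σ z₀ (x, s)) q) ?_ ?_ ?_
    · intro s hs
      exact (hasDerivAt_sidePoint_tangent (f := fun w => Φ w q.1 q.2)
        (hDρ j (x, s) (hcomm hs) q hq hd).1).const_mul a
    · intro s hs
      exact (hasDerivAt_sidePoint_tangent (f := fun w => D₁ j w q)
        (hDρ j (x, s) (hcomm hs) q hq hd).2).const_mul a
    · exact fun s hs => (hsign (x, s) (hcomm hs) q hq hd).1
  -- As x points inward, ∂_ν = -∂_x, and the Robin condition becomes G_x = hG.
  have hrob : ∀ q ∈ Q, dist q q₀ < ρ → ∀ s : ℝ, s ^ 2 < ρ ^ 2 →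
      HasDerivAt (fun x => G q x s) (q.2 * G q 0 s) 0 := by
    intro q hq hd s hs
    have hmem : (0 : ℝ) ^ 2 + s ^ 2 < ρ ^ 2 := by linarith
    have h1 := (hDρ i (0, s) hmem q hq hd).1
    have h2 := (hΦ.eigenfunction q.1 hq.1 q.2 hq.2.1).robin.normal_deriv hσ
      (sidePoint_mem_openSide hij hz₀ (htangent s hs)) h1
    have h3 := (hasDerivAt_sidePoint_normal (f := fun w => Φ w q.1 q.2) h1).const_mul a
    refine h3.congr_deriv ?_
    simp only [hG]
    linear_combination -a * h2
  have hG0 : G q₀ 0 0 = 0 := by simp only [hG, sidePoint_zero, hq₀def, hzero, mul_zero]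
  have hGd : HasDerivAt (fun s => G q₀ 0 s) 0 0 := by
    have h1 := (hDρ j (0, 0) (by simpa using pow_pos hρ 2) q₀ hq₀ (by simpa using hρ)).1
    have h2 := (hasDerivAt_sidePoint_tangent (f := fun w => Φ w q₀.1 q₀.2) h1).const_mul a
    refine h2.congr_deriv ?_
    rw [sidePoint_zero, hD₁j, mul_zero]
  have hε : 0 < ρ / 2 := by linarith
  have hερ : ρ / 2 < ρ := by linarith
  have hε2 : (ρ / 2) ^ 2 < ρ ^ 2 := by nlinarith
  obtain ⟨hneg, hpos, η, hη, hpieces⟩ := exists_isPreconnected_pieces hε hερ hq₀ hG0 hGd hGc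
    (fun q hq => hq.2.1.1) hconc hconv hrob
  have hunion : ∀ (q : ℝ × ℝ) (b : ℝ),
      (∀ p ∈ halfDisc (ρ / 2), 0 < G q p.1 p.2 → p.2 ≠ b) → _ := fun q b hb =>
    nodalSet_eq_union hij hσ hz₀ hε (by linarith) (fun s hs => htangent s (hs.trans hε2))
      (f := fun w => Φ w q.1 q.2) ha hb
  have himage : ∀ A : Set (ℝ × ℝ), IsPreconnected A → IsPreconnected (sidePoint i j σ z₀ '' A) :=
    fun A hA => hA.image _ continuous_sidePoint.continuousOn
  refine ⟨ρ / 2, hε, by linarith, min η η₁ / 2, by positivity,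
    by linarith [min_le_right η η₁], ?_, ?_⟩
  · obtain ⟨b, hN, hP, hP', hb, hb0⟩ := hpieces q₀ hq₀ (by simpa using hη)
    obtain rfl := hb0 rfl
    have hopen : ∀ A : Set (ℝ × ℝ), IsOpen A → IsOpen (sidePoint i j σ z₀ '' A) :=
      fun A hA => (sideHomeomorph hij hσσ z₀).isOpenMap A hA
    have hinj : Function.Injective (sidePoint i j σ z₀) :=
      (sideHomeomorph hij hσσ z₀).injective
    have hcont : ContinuousOn (fun p : ℝ × ℝ => G q₀ p.1 p.2) {p | p.1 ^ 2 + p.2 ^ 2 < ρ ^ 2} :=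
      hGc.comp (f := fun p : ℝ × ℝ => (p, q₀)) (by fun_prop) fun p hp => ⟨hp, hq₀⟩
    have hcont' : ContinuousOn (fun p : ℝ × ℝ => G q₀ p.1 p.2) (halfDisc (ρ / 2)) :=
      hcont.mono fun p hp => lt_trans hp.2 hε2
    have hPo : IsOpen {p ∈ halfDisc (ρ / 2) | 0 < G q₀ p.1 p.2} :=
      hcont'.isOpen_inter_preimage (isOpen_halfDisc _) isOpen_Ioi
    have hsplit : ∀ I : Set ℝ, {p ∈ halfDisc (ρ / 2) | 0 < G q₀ p.1 p.2 ∧ p.2 ∈ I} =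
        {p ∈ halfDisc (ρ / 2) | 0 < G q₀ p.1 p.2} ∩ Prod.snd ⁻¹' I := by
      intro I; ext p; exact and_assoc.symm
    have hnonempty : ∀ c : ℝ, c ^ 2 = (ρ / 4) ^ 2 → ∀ I : Set ℝ, c ∈ I →
        {p ∈ halfDisc (ρ / 2) | 0 < G q₀ p.1 p.2 ∧ p.2 ∈ I}.Nonempty := by
      intro c hc2 I hcI
      have hDo : IsOpen {p : ℝ × ℝ | p.1 ^ 2 + p.2 ^ 2 < (ρ / 2) ^ 2} :=
        isOpen_lt (by fun_prop) (by fun_prop)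
      have hO := (hcont.mono fun p hp => lt_trans hp hε2).isOpen_inter_preimage hDo
        (isOpen_Ioi (a := (0 : ℝ)))
      have hmem : ((0 : ℝ), c) ∈ {p : ℝ × ℝ | p.1 ^ 2 + p.2 ^ 2 < (ρ / 2) ^ 2} ∩
          (fun p : ℝ × ℝ => G q₀ p.1 p.2) ⁻¹' Ioi 0 := by
        refine ⟨?_, hpos c (by nlinarith) (by rintro rfl; nlinarith)⟩
        show (0 : ℝ) ^ 2 + c ^ 2 < (ρ / 2) ^ 2
        nlinarith
      -- The positive value at the boundary point (0, c) persists slightly inside the half-disc.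
      have hev : ∀ᶠ x in nhdsWithin (0 : ℝ) (Ioi 0), (x, c) ∈
          {p : ℝ × ℝ | p.1 ^ 2 + p.2 ^ 2 < (ρ / 2) ^ 2} ∩
          (fun p : ℝ × ℝ => G q₀ p.1 p.2) ⁻¹' Ioi 0 := by
        have : ContinuousAt (fun x : ℝ => (x, c)) 0 := by fun_prop
        exact nhdsWithin_le_nhds (this.preimage_mem_nhds (hO.mem_nhds hmem))
      obtain ⟨x, hx, hx0⟩ := (hev.and self_mem_nhdsWithin).exists
      exact ⟨(x, c), ⟨hx0, hx.1⟩, hx.2, hcI⟩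
    refine nodalDomains_encard_eq_three (himage _ hN) (himage _ hP) (himage _ hP')
      (hopen _ (hcont'.isOpen_inter_preimage (isOpen_halfDisc _) isOpen_Iio))
      (hopen _ (by rw [hsplit]; exact hPo.inter (isOpen_Iio.preimage continuous_snd)))
      (hopen _ (by rw [hsplit]; exact hPo.inter (isOpen_Ioi.preimage continuous_snd)))
      (Nonempty.image _ ⟨(ρ / 4, 0), ⟨by simp only; linarith, by simp only; nlinarith⟩,
        hneg _ (by linarith) (by linarith)⟩)
      (Nonempty.image _ (hnonempty (-(ρ / 4)) (by ring) _ (by simp only [mem_Iio]; linarith)))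
      (Nonempty.image _ (hnonempty (ρ / 4) rfl _ (by simp only [mem_Ioi]; linarith)))
      ((disjoint_image_iff hinj).2 (disjoint_left.2 fun p h h' => lt_asymm h.2 h'.2.1))
      ((disjoint_image_iff hinj).2 (disjoint_left.2 fun p h h' => lt_asymm h.2 h'.2.1))
      ((disjoint_image_iff hinj).2 (disjoint_left.2 fun p h h' => lt_asymm (show p.2 < 0 from h.2.2) h'.2.2))
      (hunion q₀ 0 hb)
  · intro θ hθ h hh hle
    have hm1 := min_le_left η η₁
    have hm2 := min_le_right η η₁
    have hm : 0 < min η η₁ := lt_min hη hη₁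
    have hq : (θ, h) ∈ Q := ⟨hθ, hh, by simp only; linarith⟩
    have hd : dist (θ, h) q₀ < η := by
      rw [Prod.dist_eq, Real.dist_eq, Real.dist_eq]
      refine max_lt ?_ ?_
      · simp only [hq₀def]; linarith [hh.1]
      · simp only [hq₀def, sub_zero, abs_of_nonneg hh.1]; linarith [abs_nonneg (θ - θ₀)]
    obtain ⟨b, hN, hP, hP', hb, -⟩ := hpieces (θ, h) hq hd
    exact nodalDomains_encard_le_three (himage _ hN) (himage _ hP) (himage _ hP')
      (hunion (θ, h) b hb)
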